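/- All monoids are commutative and written additively. For a monoid $M$, let $M^{*}$ be its group of units, $\overline{M}=M/M^{*}$ its sharpening, and $M^{gp}$ its group completion. A monoid $M$ is \emph{sharp} if $M^{*}=\{0\}$, \emph{integral} if it is cancellative, \emph{fine} if it is integral and finitely generated, and \emph{saturated} if it is integral and every $x\in M^{gp}$ such that $nx\in M$ for some integer $n>0$ lies in $M$; it is \emph{toric} if it is fine and saturated and $M^{gp}$ is torsion free. The saturation of $M$ is the submonoid $M^{sat}\subseteq M^{gp}$ of all $x\in M^{gp}$ such that $nx$ lies in the image of $M$ for some integer $n>0$. Put $H(M)=\mathrm{Hom}(M,\mathbb{N})$, the monoid of homomorphisms $M\to\mathbb{N}$ under pointwise addition; $H$ is a contravariant functor through precomposition. Theorem. Let $Q$ be a fine monoid. 1. The monoid $H(Q)$ is fine, saturated and sharp. 2. The natural homomorphism $H(Q)^{gp}\to \mathrm{Hom}(Q^{gp},\mathbb{Z})$, which extends each $h:Q\to\mathbb{N}\subseteq\mathbb{Z}$ to $Q^{gp}$, factors through an isomorphism $$\epsilon: H(Q)^{gp}\to \mathrm{Hom}(\overline{Q}^{gp},\mathbb{Z}),$$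 that is, it is $\epsilon$ followed by composition with the map $Q^{gp}\to\overline{Q}^{gp}$ induced by $Q\to\overline{Q}$. 3. The evaluation map $ev:Q\to H(H(Q))$, $q\mapsto(h\mapsto h(q))$, factors as the canonical map $Q\to Q^{sat}\to\overline{Q^{sat}}$ followed by an isomorphism $$\overline{ev}:\overline{Q^{sat}}\to H(H(Q)).$$ Consequently $H$ induces a contravariant involution of the category of sharp toric monoids (the full subcategory of the category of commutative monoids): $H$ maps sharp toric monoids to sharp toric monoids, the evaluation maps $M\to H(H(M))$ form a natural isomorphism from the identity functor of this category to $H\circ H$, and $H$ is an equivalence from the opposite of this category to the category itself. In particular, this category is self-dual. -/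

import Mathlib

universe u

open CategoryTheory
open Algebra (GrothendieckAddGroup)

namespace MonoidDuality

/-- A commutative monoid is fine if it is integral (cancellative) and finitely generated. -/
def IsFine (M : Type u) [AddCommMonoid M] : Prop :=
  IsCancelAdd M ∧ AddMonoid.FG M

/-- A commutative monoid is sharp if `0` is its only unit. -/
def IsSharp (M : Type u) [AddCommMonoid M] : Prop :=
  ∀ x : M, IsAddUnit x → x = 0

/-- The saturation `M^sat`: the elements of `M^gp` that have a positive multiple in (the image
of) `M`. -/
def saturation (M : Type u) [AddCommMonoid M] : AddSubmonoid (GrothendieckAddGroup M) where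
  carrier := {x | ∃ n : ℕ, 0 < n ∧ ∃ m : M, n • x = GrothendieckAddGroup.of m}
  zero_mem' := ⟨1, one_pos, 0, by simp⟩
  add_mem' := by
    rintro x y ⟨n, hn, a, ha⟩ ⟨k, hk, b, hb⟩
    refine ⟨n * k, Nat.mul_pos hn hk, k • a + n • b, ?_⟩
    rw [map_add, map_nsmul, map_nsmul, ← ha, ← hb, nsmul_add, mul_nsmul, mul_comm n k, mul_nsmul]

/-- A commutative monoid `M` is saturated if it is integral and every `x` in `M^gp` with a positive
multiple in `M` lies in `M`. -/
def IsSaturated (M : Type u) [AddCommMonoid M] : Prop :=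
  IsCancelAdd M ∧
    ∀ (x : GrothendieckAddGroup M) (n : ℕ), 0 < n →
      (∃ m : M, n • x = GrothendieckAddGroup.of m) → ∃ m : M, x = GrothendieckAddGroup.of m

/-- A commutative monoid is toric if it is fine and saturated and `M^gp` is torsion free. -/
def IsToric (M : Type u) [AddCommMonoid M] : Prop :=
  IsFine M ∧ IsSaturated M ∧ IsAddTorsionFree (GrothendieckAddGroup M)

/-- The congruence on `M` whose classes are the orbits of the group of units `M^*`. -/
def unitsCon (M : Type u) [AddCommMonoid M] : AddCon M where
  r x y := ∃ v : AddUnits M, x + v = y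
  iseqv :=
    { refl := fun x => ⟨0, by simp⟩
      symm := by
        rintro x _ ⟨v, rfl⟩
        exact ⟨-v, by simp⟩
      trans := by
        rintro x _ _ ⟨v, rfl⟩ ⟨w, rfl⟩
        exact ⟨v + w, by simp [add_assoc]⟩ }
  add' := by
    rintro x _ z _ ⟨v, rfl⟩ ⟨w, rfl⟩
    exact ⟨v + w, by simp only [AddUnits.val_add]; exact add_add_add_comm _ _ _ _⟩

/-- The sharpening `M / M^*` of `M`. -/
abbrev Sharpening (M : Type u) [AddCommMonoid M] : Type u :=
  (unitsCon M).Quotient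

/-- The quotient map from `M` to its sharpening. -/
def toSharpening (M : Type u) [AddCommMonoid M] : M →+ Sharpening M :=
  (unitsCon M).mk'

/-- The canonical map from `M` to `M^sat`. -/
def toSaturation (M : Type u) [AddCommMonoid M] : M →+ saturation M :=
  (GrothendieckAddGroup.of (M := M)).codRestrict (saturation M)
    fun m => ⟨1, one_pos, m, one_nsmul _⟩

/-- The dual monoid `H(M) = Hom(M, ℕ)`, with pointwise addition. -/
abbrev H (M : Type u) [AddCommMonoid M] : Type u := M →+ ℕ

/-- The evaluation map `M → H(H(M))`, `m ↦ (h ↦ h m)`. -/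
def ev (M : Type u) [AddCommMonoid M] : M →+ H (H M) :=
  AddMonoidHom.eval

/-- The homomorphism `M^gp → N^gp` induced by `f : M → N`. -/
noncomputable def gpMap {M N : Type u} [AddCommMonoid M] [AddCommMonoid N] (f : M →+ N) :
    GrothendieckAddGroup M →+ GrothendieckAddGroup N :=
  GrothendieckAddGroup.lift (GrothendieckAddGroup.of.comp f)

/-- The homomorphism `H(M) → Hom(M^gp, ℤ)` that extends `h : M → ℕ ⊆ ℤ` to `M^gp`. -/
noncomputable def extendGp (M : Type u) [AddCommMonoid M] :
    H M →+ (GrothendieckAddGroup M →+ ℤ) where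
  toFun h := GrothendieckAddGroup.lift ((Nat.castAddMonoidHom ℤ).comp h)
  map_zero' := by
    apply GrothendieckAddGroup.lift.symm.injective
    rw [Equiv.symm_apply_apply]
    ext x
    simp [GrothendieckAddGroup.lift_symm_apply]
  map_add' h k := by
    apply GrothendieckAddGroup.lift.symm.injective
    rw [Equiv.symm_apply_apply]
    have key (l : H M) (x : M) :
        GrothendieckAddGroup.lift ((Nat.castAddMonoidHom ℤ).comp l) (GrothendieckAddGroup.of x)
          = (l x : ℤ) :=
      DFunLike.congr_fun
        (GrothendieckAddGroup.lift.symm_apply_apply ((Nat.castAddMonoidHom ℤ).comp l)) x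
    ext x
    simp only [GrothendieckAddGroup.lift_symm_apply, AddMonoidHom.comp_apply,
      AddMonoidHom.add_apply, key]
    simp

/-- The natural homomorphism `H(M)^gp → Hom(M^gp, ℤ)`. -/
noncomputable def gpDual (M : Type u) [AddCommMonoid M] :
    GrothendieckAddGroup (H M) →+ (GrothendieckAddGroup M →+ ℤ) :=
  GrothendieckAddGroup.lift (extendGp M)

/-- `H` as a contravariant functor on commutative monoids; it acts on morphisms by
precomposition. -/
def HFunctor : AddCommMonCat.{u}ᵒᵖ ⥤ AddCommMonCat.{u} where
  obj M := AddCommMonCat.of (H M.unop)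
  map f := AddCommMonCat.ofHom (AddMonoidHom.compHom' f.unop.hom)

/-- The property of commutative monoids of being sharp and toric. -/
def sharpToric : ObjectProperty AddCommMonCat.{u} :=
  fun M => IsSharp M ∧ IsToric M

/-- The category of sharp toric monoids, a full subcategory of commutative monoids. -/
abbrev SharpToricMon : Type (u + 1) := (sharpToric.{u}).FullSubcategory

/-- The restriction of `H` to sharp toric monoids, given that `H` preserves them. -/
def dualityFunctor (hH : ∀ M : AddCommMonCat.{u}, sharpToric M →
    sharpToric (HFunctor.obj (Opposite.op M))) :
    SharpToricMon.{u}ᵒᵖ ⥤ SharpToricMon.{u} :=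
  sharpToric.lift ((sharpToric.{u}).ι.op ⋙ HFunctor)
    fun M => hH M.unop.obj M.unop.property

end MonoidDuality

open MonoidDuality

namespace MonoidDuality

/-! Everything rests on Farkas' lemma over the integers, `exists_nsmul_mem_closure_or_exists_hom`.
For Q finitely generated it says that Q^sat is exactly the part of Q^gp where every h in H(Q) is
nonnegative (`mem_saturation_of_nonneg`, `extendGp_nonneg`). Hence elements of Q^sat that H(Q) does
not separate differ by a unit.

For Q fine, Farkas at -q gives an h that is nonzero at a given nonunit q. Summing yields a k
positive on all nonunit generators, and adding a large multiple of k to a functional that kills Q^*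
makes it nonnegative. Such functionals are therefore differences of elements of H(Q), which gives ε.
Through ε, any φ in H(H(Q)) becomes a functional on the dual of a finitely generated group, hence
evaluation at a point; nonnegativity of φ puts that point in Q^sat. For sharp saturated Q nothing is
lost in passing to the sharpened saturation, so `ev` itself is bijective. -/

/-- A homomorphism to the integers with nonnegative values, as a homomorphism to `ℕ`. -/
def natHomOfNonneg {M : Type*} [AddCommMonoid M] (f : M →+ ℤ) (hf : ∀ x, 0 ≤ f x) : M →+ ℕ where
  toFun x := (f x).toNat
  map_zero' := by simp
  map_add' x y := by rw [map_add, Int.toNat_add (hf x) (hf y)]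

@[simp]
theorem natHomOfNonneg_apply {M : Type*} [AddCommMonoid M] (f : M →+ ℤ) (hf : ∀ x, 0 ≤ f x)
    (x : M) : (natHomOfNonneg f hf x : ℤ) = f x :=
  Int.toNat_of_nonneg (hf x)

theorem nonneg_of_closure_eq_top {M : Type*} [AddCommMonoid M] {S : Set M}
    (hS : AddSubmonoid.closure S = ⊤) (f : M →+ ℤ) (hf : ∀ x ∈ S, 0 ≤ f x) (x : M) : 0 ≤ f x := by
  have hx : x ∈ AddSubmonoid.closure S := hS ▸ AddSubmonoid.mem_top x
  induction hx using AddSubmonoid.closure_induction with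
  | mem x hx => exact hf x hx
  | zero => simp
  | add x y _ _ hx hy => rw [map_add]; exact add_nonneg hx hy

/-! ### Functionals on finitely generated abelian groups and Farkas' lemma -/

section AbelianGroup

variable {G : Type*} [AddCommGroup G]

/-- Modulo torsion the group is free of finite rank, so functionals separate points; a sign change
makes the value negative. -/
theorem exists_hom_neg_of_nsmul_ne_zero [Module.Finite ℤ G] (x : G)
    (hx : ∀ n : ℕ, 0 < n → n • x ≠ 0) : ∃ f : G →+ ℤ, f x < 0 := by
  let B := G ⧸ Submodule.torsion ℤ G
  have hB : (Submodule.torsion ℤ G).mkQ x ≠ 0 := by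
    rw [Submodule.mkQ_apply, Ne, Submodule.Quotient.mk_eq_zero, Submodule.mem_torsion_iff]
    rintro ⟨⟨a, ha⟩, h⟩
    have ha' : a ≠ 0 := nonZeroDivisors.ne_zero ha
    refine hx a.natAbs (Int.natAbs_pos.2 ha') ?_
    have h' : a • x = 0 := h
    rcases Int.natAbs_eq a with e | e <;> rw [e] at h' <;> simpa using h'
  obtain ⟨f, hf⟩ : ∃ f : Module.Dual ℤ B, f ((Submodule.torsion ℤ G).mkQ x) ≠ 0 := by
    by_contra! h
    exact hB ((Module.forall_dual_apply_eq_zero_iff ℤ _).1 h)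
  let g : G →+ ℤ := (f.comp (Submodule.torsion ℤ G).mkQ).toAddMonoidHom
  have hg : g x ≠ 0 := hf
  rcases lt_or_gt_of_ne hg with h | h
  · exact ⟨g, h⟩
  · exact ⟨-g, by simpa using h⟩

/-- Every integral functional on the dual of a finitely generated abelian group is an evaluation. -/
theorem exists_eq_eval [Module.Finite ℤ G] (Φ : (G →+ ℤ) →+ ℤ) : ∃ y : G, ∀ g, Φ g = g y := by
  let T := Submodule.torsion ℤ G
  -- The quotient by torsion is free of finite rank, hence reflexive, and every g factors through it
  -- because ℤ is torsion free.
  let Ψ : Module.Dual ℤ (Module.Dual ℤ (G ⧸ T)) := AddMonoidHom.toIntLinearMap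
    { toFun := fun f => Φ (f.comp T.mkQ).toAddMonoidHom
      map_zero' := map_zero Φ
      map_add' := fun f g => map_add Φ (f.comp T.mkQ).toAddMonoidHom (g.comp T.mkQ).toAddMonoidHom }
  obtain ⟨y, hy⟩ := T.mkQ_surjective ((Module.evalEquiv ℤ (G ⧸ T)).symm Ψ)
  refine ⟨y, fun g => ?_⟩
  have hT : T ≤ LinearMap.ker g.toIntLinearMap := by
    intro x hx
    obtain ⟨⟨a, ha⟩, h⟩ := (Submodule.mem_torsion_iff x).1 hx
    have h' : a • x = 0 := h
    have h2 : a • g x = 0 := by rw [← map_zsmul, h', map_zero]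
    exact (smul_eq_zero.1 h2).resolve_left (nonZeroDivisors.ne_zero ha)
  have key : Ψ (T.liftQ g.toIntLinearMap hT) = T.liftQ g.toIntLinearMap hT (T.mkQ y) := by
    rw [hy, Module.apply_evalEquiv_symm_apply]
  exact key

/-- A projection along `s` with coefficients twisted by `f`. -/
def projAlong (f : G →+ ℤ) (s : G) : G →+ G :=
  (-f s) • AddMonoidHom.id G + ((zmultiplesHom G) s).comp f

@[simp]
theorem projAlong_apply (f : G →+ ℤ) (s y : G) : projAlong f s y = (-f s) • y + f y • s := by
  simp [projAlong]

theorem zsmul_mem_of_nonneg {S : AddSubmonoid G} {a : ℤ} (ha : 0 ≤ a) {x : G} (hx : x ∈ S) :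
    a • x ∈ S := by
  lift a to ℕ using ha
  rw [natCast_zsmul]
  exact S.nsmul_mem hx a

/-- Farkas' lemma for a finitely generated submonoid of a finitely generated abelian group. -/
theorem exists_nsmul_mem_closure_or_exists_hom [Module.Finite ℤ G] (l : List G) (x : G) :
    (∃ n : ℕ, 0 < n ∧ n • x ∈ AddSubmonoid.closure {a | a ∈ l}) ∨
      ∃ f : G →+ ℤ, (∀ a ∈ l, 0 ≤ f a) ∧ f x < 0 := by
  induction hk : l.length generalizing l x with
  | zero =>
    obtain rfl := List.length_eq_zero_iff.1 hk
    -- The closure is trivial here, so failure of the first alternative means that `x` is not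
    -- torsion.
    refine or_iff_not_imp_left.2 fun h => ?_
    obtain ⟨f, hf⟩ := exists_hom_neg_of_nsmul_ne_zero x fun n hn h0 =>
      h ⟨n, hn, h0 ▸ zero_mem _⟩
    exact ⟨f, by simp, hf⟩
  | succ k ih =>
    obtain ⟨s, l, rfl⟩ := List.exists_cons_of_length_eq_add_one hk
    have hl : l.length = k := by simpa using hk
    set C := AddSubmonoid.closure {a | a ∈ s :: l} with hC
    have hs : s ∈ C := AddSubmonoid.subset_closure (by simp)
    have hlC : ∀ a ∈ l, a ∈ C := fun a ha => AddSubmonoid.subset_closure (by simp [ha])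
    rcases ih l x hl with ⟨n, hn, h⟩ | ⟨f, hf, hfx⟩
    · exact .inl ⟨n, hn, AddSubmonoid.closure_mono (fun a ha => by simp_all) h⟩
    rcases le_or_gt 0 (f s) with hfs | hfs
    · exact .inr ⟨f, by simpa [hfs] using hf, hfx⟩
    -- Now `f` is nonnegative on `l` but negative at `s` and `x`. Projecting along `s` into the
    -- kernel of `f` removes one generator.
    rcases ih (l.map (projAlong f s)) (projAlong f s x) (by simpa using hl) with
      ⟨n, hn, h⟩ | ⟨g, hg, hgx⟩
    · left
      have hle : AddSubmonoid.closure {a | a ∈ l.map (projAlong f s)} ≤ C := by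
        rw [AddSubmonoid.closure_le]
        intro a ha
        obtain ⟨y, hy, rfl⟩ := List.mem_map.1 ha
        rw [projAlong_apply]
        exact add_mem (zsmul_mem_of_nonneg (by lia) (hlC y hy)) (zsmul_mem_of_nonneg (hf y hy) hs)
      -- The projection of `x` is `(-f s) • x + f x • s`; adding `(-f x) • s`, which lies in `C` as
      -- `f x < 0`, leaves a positive multiple of `x`.
      refine ⟨n * (-f s).toNat, Nat.mul_pos hn (by lia), ?_⟩
      have h2 := C.add_mem (hle h)
        (C.nsmul_mem (zsmul_mem_of_nonneg (a := -f x) (by lia) hs) n)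
      rw [projAlong_apply] at h2
      convert h2 using 1
      rw [← nsmul_add, add_assoc, ← add_zsmul, add_neg_cancel, zero_zsmul, add_zero, mul_nsmul',
        ← natCast_zsmul x, Int.toNat_of_nonneg (by lia)]
    · right
      -- The projection kills `s`, so the pulled back functional vanishes there.
      refine ⟨g.comp (projAlong f s), ?_, hgx⟩
      intro a ha
      rcases List.mem_cons.1 ha with rfl | ha
      · simp
      · exact hg _ (List.mem_map_of_mem ha)

end AbelianGroup

/-! ### Group completions and the saturation as a dual cone -/

section GroupCompletion

variable {M N : Type u} [AddCommMonoid M] [AddCommMonoid N]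

theorem lift_of {G : Type*} [AddCommGroup G] (f : M →+ G) (m : M) :
    GrothendieckAddGroup.lift f (GrothendieckAddGroup.of m) = f m :=
  DFunLike.congr_fun (GrothendieckAddGroup.lift.symm_apply_apply f) m

theorem exists_eq_of_sub_of (x : GrothendieckAddGroup M) :
    ∃ a b : M, x = GrothendieckAddGroup.of a - GrothendieckAddGroup.of b := by
  obtain ⟨⟨a, b⟩, h⟩ := (AddLocalization.addMonoidOf (⊤ : AddSubmonoid M)).surj x
  exact ⟨a, b, eq_sub_of_add_eq h⟩

theorem hom_ext_of {G : Type*} [AddCommGroup G] {f g : GrothendieckAddGroup M →+ G}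
    (h : ∀ m, f (GrothendieckAddGroup.of m) = g (GrothendieckAddGroup.of m)) : f = g := by
  ext x
  obtain ⟨a, b, rfl⟩ := exists_eq_of_sub_of x
  rw [map_sub, map_sub, h, h]

theorem extendGp_of (h : H M) (m : M) : extendGp M h (GrothendieckAddGroup.of m) = h m :=
  lift_of _ m

theorem gpDual_of (h : H M) : gpDual M (GrothendieckAddGroup.of h) = extendGp M h :=
  lift_of _ h

theorem gpMap_of (f : M →+ N) (m : M) :
    gpMap f (GrothendieckAddGroup.of m) = GrothendieckAddGroup.of (f m) :=
  lift_of _ m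

theorem gpMap_surjective {f : M →+ N} (hf : Function.Surjective f) :
    Function.Surjective (gpMap f) := by
  intro y
  obtain ⟨a, b, rfl⟩ := exists_eq_of_sub_of y
  obtain ⟨a, rfl⟩ := hf a
  obtain ⟨b, rfl⟩ := hf b
  exact ⟨GrothendieckAddGroup.of a - GrothendieckAddGroup.of b,
    by rw [map_sub, gpMap_of, gpMap_of]⟩

theorem gpDual_injective : Function.Injective (gpDual M) := by
  rw [injective_iff_map_eq_zero]
  intro x hx
  obtain ⟨h, k, rfl⟩ := exists_eq_of_sub_of x
  rw [map_sub, gpDual_of, gpDual_of, sub_eq_zero] at hx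
  rw [sub_eq_zero]
  congr 1
  ext m
  have h1 := DFunLike.congr_fun hx (GrothendieckAddGroup.of m)
  rw [extendGp_of, extendGp_of] at h1
  exact_mod_cast h1

theorem moduleFinite_groupCompletion (hM : AddMonoid.FG M) :
    Module.Finite ℤ (GrothendieckAddGroup M) := by
  have : AddMonoid.FG (GrothendieckAddGroup M) := inferInstance
  exact Module.Finite.iff_addGroup_fg.2 (AddGroup.fg_iff_addMonoid_fg.2 this)

theorem mem_saturation_of_nonneg (hM : AddMonoid.FG M) (x : GrothendieckAddGroup M)
    (hx : ∀ h : H M, 0 ≤ extendGp M h x) : x ∈ saturation M := by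
  have := moduleFinite_groupCompletion hM
  obtain ⟨S, hS⟩ := hM.fg_top
  rcases exists_nsmul_mem_closure_or_exists_hom
      (S.toList.map (GrothendieckAddGroup.of (M := M))) x with ⟨n, hn, h⟩ | ⟨f, hf, hfx⟩
  · refine ⟨n, hn, ?_⟩
    have hle : AddSubmonoid.closure {a | a ∈ S.toList.map (GrothendieckAddGroup.of (M := M))} ≤
        AddMonoidHom.mrange (GrothendieckAddGroup.of (M := M)) := by
      rw [AddSubmonoid.closure_le]
      intro a ha
      obtain ⟨y, -, rfl⟩ := List.mem_map.1 ha
      exact ⟨y, rfl⟩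
    obtain ⟨m, hm⟩ := hle h
    exact ⟨m, hm.symm⟩
  · have hpos := nonneg_of_closure_eq_top hS (f.comp GrothendieckAddGroup.of)
      fun y hy => hf _ (List.mem_map_of_mem (Finset.mem_toList.2 hy))
    have he : extendGp M (natHomOfNonneg _ hpos) = f := hom_ext_of fun m => by
      rw [extendGp_of, natHomOfNonneg_apply, AddMonoidHom.comp_apply]
    exact absurd (hx (natHomOfNonneg _ hpos)) (by rw [he]; exact not_le.2 hfx)

theorem extendGp_nonneg (h : H M) {x : GrothendieckAddGroup M} (hx : x ∈ saturation M) :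
    0 ≤ extendGp M h x := by
  obtain ⟨n, hn, m, hm⟩ := hx
  have h1 : n • extendGp M h x = h m := by rw [← map_nsmul, hm, extendGp_of]
  rw [nsmul_eq_mul] at h1
  exact nonneg_of_mul_nonneg_right (h1 ▸ Int.natCast_nonneg _) (by exact_mod_cast hn)

end GroupCompletion


/-! ### The dual of a fine monoid and its double dual -/

section Dual

variable {Q : Type u} [AddCommMonoid Q]

theorem isCancelAdd_H : IsCancelAdd (H Q) :=
  have : IsLeftCancelAdd (H Q) := ⟨fun a b c h => by
    ext q
    exact Nat.add_left_cancel (DFunLike.congr_fun h q)⟩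
  AddCommMagma.IsLeftCancelAdd.toIsCancelAdd _

theorem isSharp_H : IsSharp (H Q) := by
  rintro _ ⟨v, rfl⟩
  ext q
  have h : (v : H Q) q + (↑(-v) : H Q) q = 0 := DFunLike.congr_fun v.add_neg q
  exact (Nat.add_eq_zero_iff.1 h).1

/-- If n(h - k) takes values in ℕ, then k ≤ h pointwise, so h - k already does. -/
theorem isSaturated_H : IsSaturated (H Q) := by
  refine ⟨isCancelAdd_H, ?_⟩
  rintro x n hn ⟨m, hm⟩
  have := isCancelAdd_H (Q := Q)
  obtain ⟨h, k, rfl⟩ := exists_eq_of_sub_of x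
  rw [nsmul_sub, sub_eq_iff_eq_add, ← map_nsmul, ← map_nsmul, ← map_add] at hm
  have hm' := GrothendieckAddGroup.of_injective hm
  have hkh : ∀ q, k q ≤ h q := fun q => by
    have h1 : n * h q = m q + n * k q := by simpa using DFunLike.congr_fun hm' q
    exact Nat.le_of_mul_le_mul_left (by lia) hn
  let f : Q →+ ℤ := (Nat.castAddMonoidHom ℤ).comp h - (Nat.castAddMonoidHom ℤ).comp k
  have hf : ∀ q, 0 ≤ f q := fun q => sub_nonneg.2 (Int.ofNat_le.2 (hkh q))
  refine ⟨natHomOfNonneg f hf, ?_⟩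
  rw [sub_eq_iff_eq_add, ← map_add]
  congr 1
  ext q
  have h1 := natHomOfNonneg_apply f hf q
  have h2 : f q = h q - k q := rfl
  rw [AddMonoidHom.add_apply]
  lia

/-- Restriction of a homomorphism to `ℕ` to a finite subset of the source. -/
def restrictFinset (S : Finset Q) : H Q →+ (S → ℕ) where
  toFun h s := h s
  map_zero' := rfl
  map_add' _ _ := rfl

theorem restrictFinset_injective {S : Finset Q} (hS : AddSubmonoid.closure (S : Set Q) = ⊤) :
    Function.Injective (restrictFinset S) := fun _ _ h =>
  AddMonoidHom.eq_of_eqOn_denseM hS fun q hq => congr_fun h ⟨q, hq⟩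

/-- Restriction to generators embeds H(Q) in ℕ^S. The image is subtractive: a difference of two
homomorphisms that is nonnegative on generators is nonnegative everywhere. Subtractive submonoids of
ℕ^S are finitely generated, by Dickson's lemma. -/
theorem fg_H (hQ : AddMonoid.FG Q) : AddMonoid.FG (H Q) := by
  obtain ⟨S, hS⟩ := hQ.fg_top
  have hfg : (AddMonoidHom.mrange (restrictFinset S)).FG := by
    refine AddSubmonoid.fg_of_subtractive ?_
    rintro _ ⟨h, rfl⟩ y ⟨k, hk⟩
    let f : Q →+ ℤ := (Nat.castAddMonoidHom ℤ).comp k - (Nat.castAddMonoidHom ℤ).comp h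
    have hfy : ∀ s (hs : s ∈ S), f s = y ⟨s, hs⟩ := fun s hs => by
      have h1 : k s = h s + y ⟨s, hs⟩ := congr_fun hk ⟨s, hs⟩
      have h2 : f s = k s - h s := rfl
      lia
    have hf := nonneg_of_closure_eq_top hS f fun s hs => hfy s hs ▸ Int.natCast_nonneg _
    refine ⟨natHomOfNonneg f hf, ?_⟩
    ext s
    have h1 := natHomOfNonneg_apply f hf s
    rw [hfy s s.2] at h1
    exact_mod_cast h1
  have := (AddMonoid.fg_iff_addSubmonoid_fg _).2 hfg
  let e := AddEquiv.ofBijective (restrictFinset S).mrangeRestrict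
    ⟨fun a b h => restrictFinset_injective hS (congr_arg Subtype.val h),
      (restrictFinset S).mrangeRestrict_surjective⟩
  exact AddMonoid.fg_of_surjective e.symm.toAddMonoidHom e.symm.surjective

theorem isFine_H (hQ : AddMonoid.FG Q) : IsFine (H Q) :=
  ⟨isCancelAdd_H, fg_H hQ⟩

theorem map_eq_zero_of_isAddUnit (h : H Q) {q : Q} (hq : IsAddUnit q) : h q = 0 := by
  simpa using hq.map h

theorem toSharpening_surjective : Function.Surjective (toSharpening Q) :=
  AddCon.mk'_surjective

theorem toSharpening_eq_iff {a b : Q} :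
    toSharpening Q a = toSharpening Q b ↔ ∃ v : AddUnits Q, a + v = b :=
  (unitsCon Q).eq

/-- A homomorphism that kills the units, as a homomorphism on the sharpening. -/
def liftSharpening {N : Type*} [AddCommMonoid N] (f : Q →+ N)
    (hf : ∀ q, IsAddUnit q → f q = 0) : Sharpening Q →+ N :=
  (unitsCon Q).lift f (by
    rintro x _ ⟨v, rfl⟩
    rw [AddCon.ker_apply, map_add, hf v v.isAddUnit, add_zero])

theorem liftSharpening_toSharpening {N : Type*} [AddCommMonoid N] (f : Q →+ N)
    (hf : ∀ q, IsAddUnit q → f q = 0) (q : Q) :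
    liftSharpening f hf (toSharpening Q q) = f q :=
  rfl

theorem exists_extendGp_eq_comp (h : H Q) :
    ∃ g : GrothendieckAddGroup (Sharpening Q) →+ ℤ,
      extendGp Q h = g.comp (gpMap (toSharpening Q)) := by
  refine ⟨extendGp _ (liftSharpening h fun _ => map_eq_zero_of_isAddUnit h), hom_ext_of fun q => ?_⟩
  rw [AddMonoidHom.comp_apply, gpMap_of, extendGp_of, extendGp_of, liftSharpening_toSharpening]

/-- If all of H(Q) vanished at q, then -q would lie in the saturation, so n(-q) = m in Q for some n
> 0, and nq + m = 0 would make q a unit. -/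
theorem exists_H_ne_zero (hQ : IsFine Q) {q : Q} (hq : ¬ IsAddUnit q) : ∃ h : H Q, h q ≠ 0 := by
  by_contra! H0
  have := hQ.1
  obtain ⟨n, hn, m, hm⟩ := mem_saturation_of_nonneg hQ.2 (-GrothendieckAddGroup.of q) fun h => by
    rw [map_neg, extendGp_of, H0]
    simp
  rw [smul_neg, neg_eq_iff_add_eq_zero, ← map_nsmul, ← map_add,
    ← map_zero (GrothendieckAddGroup.of (M := Q))] at hm
  have h1 := GrothendieckAddGroup.of_injective hm
  obtain ⟨k, rfl⟩ := Nat.exists_eq_succ_of_ne_zero hn.ne'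
  rw [succ_nsmul', add_assoc] at h1
  exact hq (IsAddUnit.of_add_eq_zero _ h1)

theorem exists_H_ne_zero_on_nonunits (hQ : IsFine Q) (S : Finset Q) :
    ∃ h : H Q, ∀ q ∈ S, ¬ IsAddUnit q → h q ≠ 0 := by
  choose! f hf using fun (q : Q) (hq : ¬ IsAddUnit q) => exists_H_ne_zero hQ hq
  refine ⟨∑ q ∈ S, f q, fun q hq hu h0 => hf q hu ?_⟩
  rw [AddMonoidHom.finsetSum_apply, Finset.sum_eq_zero_iff] at h0
  exact h0 q hq

theorem exists_eq_sub_of_map_isAddUnit (hQ : IsFine Q) (f : Q →+ ℤ)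
    (hf : ∀ q, IsAddUnit q → f q = 0) : ∃ h k : H Q, ∀ q, f q = h q - k q := by
  obtain ⟨S, hS⟩ := hQ.2.fg_top
  obtain ⟨k, hk⟩ := exists_H_ne_zero_on_nonunits hQ S
  -- This `n` bounds |f| on every generator, and `k` is at least 1 on nonunit ones, so `f + n • k`
  -- is nonnegative on `S`.
  let n := ∑ q ∈ S, (f q).natAbs
  let g : Q →+ ℤ := f + (Nat.castAddMonoidHom ℤ).comp (n • k)
  have hgq : ∀ q, g q = f q + (n • k) q := fun _ => rfl
  have hg := nonneg_of_closure_eq_top hS g fun q hq => by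
    rw [hgq]
    by_cases hu : IsAddUnit q
    · rw [hf q hu]; lia
    · have h1 : (f q).natAbs ≤ n := Finset.single_le_sum (f := fun q => (f q).natAbs)
        (fun _ _ => Nat.zero_le _) hq
      have h2 : n ≤ (n • k) q := Nat.le_mul_of_pos_right n (Nat.pos_of_ne_zero (hk q hq hu))
      lia
  refine ⟨natHomOfNonneg g hg, n • k, fun q => ?_⟩
  rw [natHomOfNonneg_apply, hgq]
  lia

/-- Precomposition with `Q^gp → (Q/Q^*)^gp`. -/
noncomputable def compSharpening (Q : Type u) [AddCommMonoid Q] :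
    (GrothendieckAddGroup (Sharpening Q) →+ ℤ) →+ (GrothendieckAddGroup Q →+ ℤ) :=
  AddMonoidHom.compHom' (gpMap (toSharpening Q))

theorem compSharpening_injective : Function.Injective (compSharpening Q) := fun _ _ h =>
  (AddMonoidHom.cancel_right (gpMap_surjective toSharpening_surjective)).1 h

theorem range_gpDual (hQ : IsFine Q) : (gpDual Q).range = (compSharpening Q).range := by
  apply le_antisymm
  · rintro _ ⟨x, rfl⟩
    obtain ⟨h, k, rfl⟩ := exists_eq_of_sub_of x
    obtain ⟨a, ha⟩ := exists_extendGp_eq_comp h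
    obtain ⟨b, hb⟩ := exists_extendGp_eq_comp k
    refine ⟨a - b, ?_⟩
    rw [map_sub, map_sub, gpDual_of, gpDual_of, ha, hb]
    rfl
  · rintro _ ⟨g, rfl⟩
    let f : Q →+ ℤ := g.comp (GrothendieckAddGroup.of.comp (toSharpening Q))
    obtain ⟨h, k, hhk⟩ := exists_eq_sub_of_map_isAddUnit hQ f (by
      rintro _ ⟨v, rfl⟩
      have h1 : toSharpening Q v = toSharpening Q 0 :=
        toSharpening_eq_iff.2 ⟨-v, v.add_neg⟩
      simp only [f, AddMonoidHom.comp_apply]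
      rw [h1, map_zero, map_zero, map_zero])
    refine ⟨GrothendieckAddGroup.of h - GrothendieckAddGroup.of k, hom_ext_of fun q => ?_⟩
    rw [map_sub, gpDual_of, gpDual_of, AddMonoidHom.sub_apply, extendGp_of, extendGp_of, ← hhk]
    change _ = g (gpMap (toSharpening Q) (GrothendieckAddGroup.of q))
    rw [gpMap_of]
    rfl

/-- The isomorphism `H(Q)^gp ≃ Hom((Q/Q^*)^gp, ℤ)` for a fine monoid `Q`. -/
noncomputable def gpDualEquiv (hQ : IsFine Q) :
    GrothendieckAddGroup (H Q) ≃+ (GrothendieckAddGroup (Sharpening Q) →+ ℤ) :=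
  ((AddMonoidHom.ofInjective gpDual_injective).trans
    (AddEquiv.addSubgroupCongr (range_gpDual hQ))).trans
    (AddMonoidHom.ofInjective compSharpening_injective).symm

theorem gpDual_eq_gpDualEquiv_comp (hQ : IsFine Q) (x : GrothendieckAddGroup (H Q)) :
    gpDual Q x = (gpDualEquiv hQ x).comp (gpMap (toSharpening Q)) := by
  have h := congr_arg Subtype.val
    ((AddMonoidHom.ofInjective compSharpening_injective).apply_symm_apply
      (AddEquiv.addSubgroupCongr (range_gpDual hQ) (AddMonoidHom.ofInjective gpDual_injective x)))
  exact h.symm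

/-- Transported through ε, the extension of φ to H(Q)^gp is evaluation at a point of the completed
sharpening, which lifts to Q^gp. -/
theorem exists_forall_eq_extendGp (hQ : IsFine Q) (φ : H (H Q)) :
    ∃ x : GrothendieckAddGroup Q, ∀ h : H Q, (φ h : ℤ) = extendGp Q h x := by
  have : AddMonoid.FG Q := hQ.2
  have := moduleFinite_groupCompletion
    (AddMonoid.fg_of_surjective (toSharpening Q) toSharpening_surjective)
  obtain ⟨y, hy⟩ := exists_eq_eval
    ((extendGp (H Q) φ).comp (gpDualEquiv hQ).symm.toAddMonoidHom)
  obtain ⟨x, rfl⟩ := gpMap_surjective toSharpening_surjective y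
  refine ⟨x, fun h => ?_⟩
  have h1 := hy (gpDualEquiv hQ (GrothendieckAddGroup.of h))
  rw [← AddMonoidHom.comp_apply, ← gpDual_eq_gpDualEquiv_comp, gpDual_of] at h1
  rw [← h1]
  change _ = extendGp (H Q) φ ((gpDualEquiv hQ).symm (gpDualEquiv hQ _))
  rw [AddEquiv.symm_apply_apply, extendGp_of]

theorem extendGp_flip_nonneg (x : saturation Q) (h : H Q) : 0 ≤ (extendGp Q).flip x h :=
  extendGp_nonneg h x.2

/-- Evaluation of homomorphisms to `ℕ` at elements of the saturation. -/
noncomputable def evSaturation (Q : Type u) [AddCommMonoid Q] : saturation Q →+ H (H Q) where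
  toFun x := natHomOfNonneg ((extendGp Q).flip x) (extendGp_flip_nonneg x)
  map_zero' := by
    ext h
    exact Int.natCast_inj.1 ((natHomOfNonneg_apply _ _ h).trans (map_zero (extendGp Q h)))
  map_add' x y := by
    ext h
    refine Int.natCast_inj.1 ((natHomOfNonneg_apply _ _ h).trans ?_)
    rw [AddMonoidHom.add_apply, Nat.cast_add, natHomOfNonneg_apply, natHomOfNonneg_apply]
    exact map_add (extendGp Q h) (x : GrothendieckAddGroup Q) y

theorem evSaturation_apply (x : saturation Q) (h : H Q) :
    (evSaturation Q x h : ℤ) = extendGp Q h x :=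
  natHomOfNonneg_apply ((extendGp Q).flip x) (extendGp_flip_nonneg x) h

theorem evSaturation_toSaturation (q : Q) : evSaturation Q (toSaturation Q q) = ev Q q := by
  ext h
  have h1 : (evSaturation Q (toSaturation Q q) h : ℤ) = h q :=
    (evSaturation_apply _ h).trans (extendGp_of h q)
  exact_mod_cast h1

theorem evSaturation_surjective (hQ : IsFine Q) : Function.Surjective (evSaturation Q) := by
  intro φ
  obtain ⟨x, hx⟩ := exists_forall_eq_extendGp hQ φ
  refine ⟨⟨x, mem_saturation_of_nonneg hQ.2 x fun h => hx h ▸ Int.natCast_nonneg _⟩, ?_⟩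
  ext h
  have h1 := evSaturation_apply ⟨x, mem_saturation_of_nonneg hQ.2 x
    fun h => hx h ▸ Int.natCast_nonneg _⟩ h
  rw [← hx h] at h1
  exact_mod_cast h1

theorem exists_addUnits_add_eq_of_evSaturation_eq (hQ : AddMonoid.FG Q) {x y : saturation Q}
    (hxy : evSaturation Q x = evSaturation Q y) : ∃ v : AddUnits (saturation Q), x + v = y := by
  have h0 : ∀ h : H Q, extendGp Q h x = extendGp Q h y := fun h => by
    rw [← evSaturation_apply, hxy, evSaturation_apply]
  -- Every h vanishes on both differences, so both lie in the saturation and are inverse units.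
  refine ⟨⟨⟨y - x, mem_saturation_of_nonneg hQ _ fun h => by simp [h0]⟩,
    ⟨x - y, mem_saturation_of_nonneg hQ _ fun h => by simp [h0]⟩,
    Subtype.ext (by simp), Subtype.ext (by simp)⟩, Subtype.ext (by simp)⟩

/-- The homomorphism from the sharpened saturation to the double dual induced by evaluation. -/
noncomputable def evBar (Q : Type u) [AddCommMonoid Q] :
    Sharpening (saturation Q) →+ H (H Q) :=
  liftSharpening (evSaturation Q) fun _ hx => isSharp_H _ (hx.map (evSaturation Q))

theorem evBar_bijective (hQ : IsFine Q) : Function.Bijective (evBar Q) := by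
  constructor
  · intro a b hab
    obtain ⟨x, rfl⟩ := toSharpening_surjective a
    obtain ⟨y, rfl⟩ := toSharpening_surjective b
    exact toSharpening_eq_iff.2 (exists_addUnits_add_eq_of_evSaturation_eq hQ.2 hab)
  · intro φ
    obtain ⟨x, hx⟩ := evSaturation_surjective hQ φ
    exact ⟨toSharpening _ x, hx⟩

end Dual

/-! ### Sharp toric monoids and the self-duality -/

section SharpToric

variable {M : Type u} [AddCommMonoid M]

theorem IsSaturated.toSaturation_surjective (hM : IsSaturated M) :
    Function.Surjective (toSaturation M) := by
  rintro ⟨x, n, hn, m, hm⟩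
  obtain ⟨y, rfl⟩ := hM.2 x n hn ⟨m, hm⟩
  exact ⟨y, rfl⟩

theorem IsSaturated.toSaturation_injective (hM : IsSaturated M) :
    Function.Injective (toSaturation M) := fun _ _ h =>
  have := hM.1
  GrothendieckAddGroup.of_injective (congr_arg Subtype.val h)

theorem ev_bijective (hs : IsSharp M) (hf : IsFine M) (hsat : IsSaturated M) :
    Function.Bijective (ev M) := by
  constructor
  · intro a b hab
    rw [← evSaturation_toSaturation, ← evSaturation_toSaturation] at hab
    obtain ⟨v, hv⟩ := exists_addUnits_add_eq_of_evSaturation_eq hf.2 hab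
    obtain ⟨m, hm⟩ := hsat.toSaturation_surjective v
    obtain ⟨m', hm'⟩ := hsat.toSaturation_surjective ↑(-v)
    have h0 : m + m' = 0 := hsat.toSaturation_injective (by
      rw [map_add, hm, hm', v.add_neg, map_zero])
    have hm0 := hs m (IsAddUnit.of_add_eq_zero _ h0)
    rw [← hm, hm0, map_zero, add_zero] at hv
    exact hsat.toSaturation_injective hv
  · intro φ
    obtain ⟨x, hx⟩ := evSaturation_surjective hf φ
    obtain ⟨m, rfl⟩ := hsat.toSaturation_surjective x
    exact ⟨m, by rw [← evSaturation_toSaturation, hx]⟩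

/-- A torsion element of M^gp lies in M by saturation; since a multiple of it is 0 it is a unit,
hence 0 by sharpness. -/
theorem isToric_of_isSharp (hs : IsSharp M) (hf : IsFine M) (hsat : IsSaturated M) :
    IsToric M := by
  refine ⟨hf, hsat, ?_⟩
  have := hf.1
  have key : ∀ (x : GrothendieckAddGroup M) (n : ℕ), n ≠ 0 → n • x = 0 → x = 0 := by
    intro x n hn hx
    obtain ⟨a, rfl⟩ := hsat.2 x n (Nat.pos_of_ne_zero hn) ⟨0, by rw [hx, map_zero]⟩
    have h1 := GrothendieckAddGroup.of_injective
      (((map_nsmul GrothendieckAddGroup.of n a).trans hx).trans (map_zero _).symm)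
    obtain ⟨k, rfl⟩ := Nat.exists_eq_succ_of_ne_zero hn
    rw [succ_nsmul'] at h1
    rw [hs a (IsAddUnit.of_add_eq_zero _ h1), map_zero]
  refine ⟨fun n hn x y hxy => sub_eq_zero.1 (key _ n hn ?_)⟩
  rw [nsmul_sub]
  exact sub_eq_zero.2 hxy

end SharpToric

theorem sharpToric_H (M : AddCommMonCat.{u}) (hM : sharpToric M) :
    sharpToric (HFunctor.obj (Opposite.op M)) :=
  ⟨isSharp_H (Q := M), isToric_of_isSharp (M := H M) isSharp_H (isFine_H hM.2.1.2) isSaturated_H⟩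

/-- The natural isomorphism from a sharp toric monoid to its double dual. -/
noncomputable def evNatIso :
    𝟭 SharpToricMon.{u} ≅
      (dualityFunctor sharpToric_H).rightOp ⋙ dualityFunctor sharpToric_H :=
  NatIso.ofComponents
    (fun M => sharpToric.isoMk
      (AddEquiv.ofBijective (ev M.obj)
        (ev_bijective M.property.1 M.property.2.1 M.property.2.2.1)).toAddCommMonCatIso)
    (fun _ => rfl)

theorem isEquivalence_dualityFunctor :
    (dualityFunctor sharpToric_H.{u}).IsEquivalence :=
  -- Evaluation serves as the unit and, read in the opposite category, as the counit.
  (CategoryTheory.Equivalence.mk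
    (dualityFunctor sharpToric_H.{u}).rightOp (dualityFunctor sharpToric_H)
    evNatIso
    (NatIso.ofComponents (fun X => (evNatIso.app X.unop).op)
      fun f => Quiver.Hom.unop_inj (evNatIso.hom.naturality f.unop).symm)).isEquivalence_inverse

end MonoidDuality

open MonoidDuality

theorem mainTheorem1 :
    (∀ (Q : Type u) [AddCommMonoid Q], IsFine Q →
      (IsFine (H Q) ∧
        IsSaturated (H Q) ∧
        IsSharp (H Q)) ∧
      (∃ ε : GrothendieckAddGroup (H Q) ≃+
          (GrothendieckAddGroup (Sharpening Q) →+ ℤ),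
        ∀ x : GrothendieckAddGroup (H Q),
          gpDual Q x =
            (ε x).comp (gpMap (toSharpening Q))) ∧
      (∃ evBar : Sharpening (saturation Q) ≃+
          H (H Q),
        ∀ q : Q,
          ev Q q =
            evBar (toSharpening (saturation Q)
              (toSaturation Q q)))) ∧
    (∃ hH : ∀ M : AddCommMonCat.{u}, sharpToric M →
        sharpToric (HFunctor.obj (Opposite.op M)),
      (dualityFunctor hH).IsEquivalence ∧
      ∃ η : 𝟭 SharpToricMon.{u} ≅
          (dualityFunctor hH).rightOp ⋙ dualityFunctor hH,
        ∀ M : SharpToricMon.{u},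
          (η.hom.app M).hom = AddCommMonCat.ofHom (ev M.obj)) := by
  refine ⟨fun Q _ hQ => ⟨⟨isFine_H hQ.2, isSaturated_H, isSharp_H⟩,
    ⟨gpDualEquiv hQ, gpDual_eq_gpDualEquiv_comp hQ⟩,
    ⟨AddEquiv.ofBijective (evBar Q) (evBar_bijective hQ), fun q => ?_⟩⟩,
    sharpToric_H, isEquivalence_dualityFunctor, evNatIso, fun _ => rfl⟩
  exact (evSaturation_toSaturation q).symm
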